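/- Let $G$ be a finite group. A subset $A \subseteq G$ is called a factor of $G$ if there is a subset $B \subseteq G$ such that every element of $G$ can be written as $ab$ for exactly one pair $(a,b) \in A \times B$ (written $G = A \cdot B$), or there is a subset $B \subseteq G$ such that every element of $G$ can be written as $ba$ for exactly one pair $(b,a) \in B \times A$ (written $G = B \cdot A$). The group $G$ has the strong CFS property if every subset $A \subseteq G$ whose cardinality $|A|$ divides $|G|$ is a factor of $G$. Theorem. A finite group has the strong CFS property if and only if it is trivial, or cyclic of prime order, or isomorphic to one of the groups $C_2^2$, $C_4$, $C_2^3$ and $C_3^2$, where $C_n$ denotes the cyclic group of order $n$. -/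

import Mathlib

/-- `A` is a left factor of `G`: there is a subset `B` with `G = A · B`, that is, every element of
`G` is `a * b` for exactly one pair `(a, b) ∈ A × B`. -/
def IsLeftFactor {G : Type*} [Group G] (A : Set G) : Prop :=
  ∃ B : Set G, Subgroup.IsComplement A B

/-- `A` is a right factor of `G`: there is a subset `B` with `G = B · A`, that is, every element of
`G` is `b * a` for exactly one pair `(b, a) ∈ B × A`. -/
def IsRightFactor {G : Type*} [Group G] (A : Set G) : Prop :=
  ∃ B : Set G, Subgroup.IsComplement B A

/-- `A` is a factor of `G`: it is a left factor or a right factor. -/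
def IsFactor {G : Type*} [Group G] (A : Set G) : Prop :=
  IsLeftFactor A ∨ IsRightFactor A

/-- A Lagrange subset of a finite group `G`: a subset whose cardinality divides `|G|`. -/
def IsLagrangeSubset {G : Type*} [Group G] [Finite G] (A : Set G) : Prop :=
  A.ncard ∣ Nat.card G

/-- The strong CFS property of a finite group: every Lagrange subset is a factor. -/
def StrongCFS (G : Type*) [Group G] [Finite G] : Prop :=
  ∀ A : Set G, IsLagrangeSubset A → IsFactor A

/-!
A factorization `G = A · B` says that the right translates `A b` tile `G`. Whether two of them are
disjoint depends only on the quotients `a⁻¹ a'` of elements of `A`, so if a larger set `A'` has no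
quotients beyond those of `A`, the translates `A' b` are disjoint too and overfill `G`. This
counting obstruction, with its mirror image for `G = B · A`, is `not_isFactor_of_quotients`.

Suppose that `G` has the strong CFS property. A factorization by a subset of a subgroup `H`
restricts to `H`, so a subset of size `p` in a subgroup of prime order `q > p` is not a factor, and
`G` must be a `p`-group (`StrongCFS.exists_card_eq_prime_pow`). If `N` is a proper normal subgroup
with more than four elements that contains a central element `u ≠ 1`, then moving the pair `{1, u}`
out of `N` and putting a pair `{y, y v}` into another coset, with `v ∈ N` different from `1`, `u`
and `u⁻¹`, gives a set of size `|N|` with as many quotients as the larger set `N ∪ {y}`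
(`not_strongCFS_of_normal`). A `p`-group of order `pᵏ` with `k ≥ 2` has such an `N` of order
`pᵏ⁻¹`, which leaves only the orders `1`, `p`, `4`, `8` and `9`. In order nine an element `g` of
order nine is excluded by `{1, g, g³}`. In order eight explicit four-element sets whose quotients
exhaust `G` exclude every group that has an element of order greater than two.

Conversely, in the exceptional groups a set `A` of intermediate size has too few quotients to
exhaust `G`, and a missed element `k` yields the complement `{1, k}` or `⟨k⟩`; only for pairs in
`C₂³` is the complement the kernel of a character.
-/

/-! ### Obstructions to being a factor -/

section Obstructions

variable {G : Type*} [Group G]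

/-- If every quotient `x⁻¹ * y` of elements of `A'` is also a quotient of elements of `A`, then the
right translates of `A'` by a complement `B` of `A` are disjoint like those of `A`, so `A'`
cannot be larger than `A`. -/
theorem ncard_le_of_isComplement_left [Finite G] {A A' B : Set G} (h : Subgroup.IsComplement A B)
    (hd : ∀ x ∈ A', ∀ y ∈ A', ∃ a ∈ A, a * (x⁻¹ * y) ∈ A) : A'.ncard ≤ A.ncard := by
  have hcard := h.card_mul_card
  have hinj : Function.Injective (fun x : A' × B => x.1.1 * x.2.1) := by
    rintro ⟨⟨x, hx⟩, b, hb⟩ ⟨⟨y, hy⟩, c, hc⟩ hxy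
    replace hxy : x * b = y * c := hxy
    obtain ⟨a, ha, ha'⟩ := hd x hx y hy
    have e2 : a * b = a * (x⁻¹ * y) * c := by
      rw [mul_assoc a, mul_assoc x⁻¹, ← hxy, inv_mul_cancel_left]
    have e3 := @h.1 (⟨a, ha⟩, ⟨b, hb⟩) (⟨_, ha'⟩, ⟨c, hc⟩) e2
    simp only [Prod.mk.injEq, Subtype.mk.injEq] at e3
    obtain ⟨-, rfl⟩ := e3
    obtain rfl := mul_right_cancel hxy
    rfl
  have hle := Nat.card_le_card_of_injective _ hinj
  rw [Nat.card_prod, ← hcard] at hle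
  refine Nat.le_of_mul_le_mul_right hle (Nat.pos_of_ne_zero fun h0 => ?_)
  rw [h0, mul_zero] at hcard
  exact Nat.card_pos.ne hcard

theorem ncard_le_of_isComplement_right [Finite G] {A A' B : Set G} (h : Subgroup.IsComplement B A)
    (hd : ∀ x ∈ A', ∀ y ∈ A', ∃ a ∈ A, x * y⁻¹ * a ∈ A) : A'.ncard ≤ A.ncard := by
  have hcard := h.card_mul_card
  have hinj : Function.Injective (fun x : B × A' => x.1.1 * x.2.1) := by
    rintro ⟨⟨b, hb⟩, x, hx⟩ ⟨⟨c, hc⟩, y, hy⟩ hxy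
    replace hxy : b * x = c * y := hxy
    obtain ⟨a, ha, ha'⟩ := hd x hx y hy
    have e2 : b * (x * y⁻¹ * a) = c * a := by
      rw [← mul_assoc, ← mul_assoc, hxy, mul_inv_cancel_right]
    have e3 := @h.1 (⟨b, hb⟩, ⟨_, ha'⟩) (⟨c, hc⟩, ⟨a, ha⟩) e2
    simp only [Prod.mk.injEq, Subtype.mk.injEq] at e3
    obtain ⟨rfl, -⟩ := e3
    obtain rfl := mul_left_cancel hxy
    rfl
  have hle := Nat.card_le_card_of_injective _ hinj
  rw [Nat.card_prod, ← hcard] at hle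
  refine Nat.le_of_mul_le_mul_left hle (Nat.pos_of_ne_zero fun h0 => ?_)
  rw [h0, zero_mul] at hcard
  exact Nat.card_pos.ne hcard

theorem not_isFactor_of_quotients [Finite G] {A A' : Set G}
    (hl : ∀ x ∈ A', ∀ y ∈ A', ∃ a ∈ A, a * (x⁻¹ * y) ∈ A)
    (hr : ∀ x ∈ A', ∀ y ∈ A', ∃ a ∈ A, x * y⁻¹ * a ∈ A) (hlt : A.ncard < A'.ncard) :
    ¬ IsFactor A := by
  rintro (⟨B, hB⟩ | ⟨B, hB⟩)
  · exact (ncard_le_of_isComplement_left hB hl).not_gt hlt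
  · exact (ncard_le_of_isComplement_right hB hr).not_gt hlt

/-- A factorization of `G` by a subset `A` of a subgroup `H` restricts to one of `H`. -/
theorem ncard_dvd_card_of_isFactor {A : Set G} {H : Subgroup G} (hA : A ⊆ H) (hf : IsFactor A) :
    A.ncard ∣ Nat.card H := by
  have hcard : Nat.card (Subtype.val ⁻¹' A : Set H) = A.ncard := by
    rw [Nat.card_coe_set_eq, Set.ncard_preimage_of_injective_subset_range Subtype.val_injective]
    rw [Subtype.range_coe_subtype]
    exact hA
  rcases hf with ⟨B, hB⟩ | ⟨B, hB⟩
  · have hc : Subgroup.IsComplement (Subtype.val ⁻¹' A : Set H) (Subtype.val ⁻¹' B : Set H) := by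
      refine ⟨?_, fun x => ?_⟩
      · rintro ⟨⟨a, ha⟩, b, hb⟩ ⟨⟨c, hc⟩, d, hd⟩ h
        have := @hB.1 (⟨a, ha⟩, ⟨b, hb⟩) (⟨c, hc⟩, ⟨d, hd⟩) (congrArg Subtype.val h)
        simp only [Prod.mk.injEq, Subtype.mk.injEq] at this ⊢
        exact ⟨Subtype.ext this.1, Subtype.ext this.2⟩
      · obtain ⟨⟨⟨a, ha⟩, b, hb⟩, hab⟩ := hB.2 x
        replace hab : a * b = x := hab
        have hbH : b ∈ H := by
          rw [← H.mul_mem_cancel_left (hA ha), hab]; exact x.2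
        exact ⟨(⟨⟨a, hA ha⟩, ha⟩, ⟨⟨b, hbH⟩, hb⟩), Subtype.ext hab⟩
    exact ⟨_, by rw [← hc.card_mul_card, hcard]⟩
  · have hc : Subgroup.IsComplement (Subtype.val ⁻¹' B : Set H) (Subtype.val ⁻¹' A : Set H) := by
      refine ⟨?_, fun x => ?_⟩
      · rintro ⟨⟨a, ha⟩, b, hb⟩ ⟨⟨c, hc⟩, d, hd⟩ h
        have := @hB.1 (⟨a, ha⟩, ⟨b, hb⟩) (⟨c, hc⟩, ⟨d, hd⟩) (congrArg Subtype.val h)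
        simp only [Prod.mk.injEq, Subtype.mk.injEq] at this ⊢
        exact ⟨Subtype.ext this.1, Subtype.ext this.2⟩
      · obtain ⟨⟨⟨b, hb⟩, a, ha⟩, hab⟩ := hB.2 x
        replace hab : b * a = x := hab
        have hbH : b ∈ H := by
          rw [← H.mul_mem_cancel_right (hA ha), hab]; exact x.2
        exact ⟨(⟨⟨b, hbH⟩, hb⟩, ⟨⟨a, hA ha⟩, ha⟩), Subtype.ext hab⟩
    exact ⟨_, by rw [mul_comm, ← hc.card_mul_card, hcard]⟩

/-- The set of powers of `g` with exponents in `D`. -/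
def powersIn (g : G) (D : Finset ℕ) : Set G := (fun i => g ^ i) '' (D : Set ℕ)

theorem ncard_powersIn {g : G} {D : Finset ℕ} (hD : ∀ d ∈ D, d < orderOf g) :
    (powersIn g D).ncard = D.card := by
  rw [powersIn, Set.InjOn.ncard_image, Set.ncard_coe_finset]
  exact pow_injOn_Iio_orderOf.mono fun d hd => hD d hd

/-- A set of powers of `g` with exponents in `D` is not a factor if the differences of `D` include
those of a larger set `D'` of exponents. -/
theorem not_strongCFS_of_powersIn [Finite G] (g : G) (D D' : Finset ℕ)
    (hD : ∀ d ∈ D, d < orderOf g) (hD' : ∀ d ∈ D', d < orderOf g) (hdvd : D.card ∣ Nat.card G)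
    (hlt : D.card < D'.card)
    (hdiff : ∀ i ∈ D', ∀ j ∈ D', ∃ k ∈ D, ∃ l ∈ D, i + l = j + k) : ¬ StrongCFS G := by
  intro hG
  have hf := hG (powersIn g D) (by rwa [IsLagrangeSubset, ncard_powersIn hD])
  refine not_isFactor_of_quotients (A' := powersIn g D') ?_ ?_ ?_ hf
  · rintro _ ⟨i, hi, rfl⟩ _ ⟨j, hj, rfl⟩
    obtain ⟨k, hk, l, hl, e⟩ := hdiff i hi j hj
    refine ⟨g ^ k, ⟨k, hk, rfl⟩, l, hl, ?_⟩
    simp only [← zpow_natCast, ← zpow_neg, ← zpow_add]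
    congr 1; omega
  · rintro _ ⟨i, hi, rfl⟩ _ ⟨j, hj, rfl⟩
    obtain ⟨k, hk, l, hl, e⟩ := hdiff j hj i hi
    refine ⟨g ^ k, ⟨k, hk, rfl⟩, l, hl, ?_⟩
    simp only [← zpow_natCast, ← zpow_neg, ← zpow_add]
    congr 1; omega
  · rwa [ncard_powersIn hD, ncard_powersIn hD']

end Obstructions

/-! ### Reduction to groups of order one, a prime, four, eight or nine -/

section Reduction

variable {G : Type*} [Group G] [Finite G]

/-- For primes `p < q` dividing `|G|`, a `p`-element subset of a subgroup of order `q` is not a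
factor. -/
theorem not_strongCFS_of_two_primes {p q : ℕ} (hp : p.Prime) (hq : q.Prime) (hpq : p < q)
    (hpG : p ∣ Nat.card G) (hqG : q ∣ Nat.card G) : ¬ StrongCFS G := by
  intro hG
  have := Fact.mk hq
  obtain ⟨g, hg⟩ := exists_prime_orderOf_dvd_card' q hqG
  have hcard : (powersIn g (Finset.range p)).ncard = p := by
    rw [ncard_powersIn fun d hd => ?_, Finset.card_range]
    rw [hg]; exact (Finset.mem_range.1 hd).trans hpq
  have hsub : powersIn g (Finset.range p) ⊆ Subgroup.zpowers g := by
    rintro _ ⟨i, -, rfl⟩; exact Subgroup.npow_mem_zpowers g i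
  have := ncard_dvd_card_of_isFactor hsub (hG _ (by rwa [IsLagrangeSubset, hcard]))
  rw [hcard, Nat.card_zpowers, hg, Nat.prime_dvd_prime_iff_eq hp hq] at this
  exact hpq.ne this

theorem StrongCFS.exists_card_eq_prime_pow (hG : StrongCFS G) (h1 : Nat.card G ≠ 1) :
    ∃ p k : ℕ, p.Prime ∧ Nat.card G = p ^ k := by
  obtain ⟨p, hp, hpG⟩ := Nat.exists_prime_and_dvd h1
  refine ⟨p, _, hp, Nat.eq_prime_pow_of_unique_prime_dvd Nat.card_pos.ne' ?_⟩
  intro q hq hqG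
  by_contra hne
  rcases lt_or_gt_of_ne hne with h | h
  · exact not_strongCFS_of_two_primes hq hp h hqG hpG hG
  · exact not_strongCFS_of_two_primes hp hq h hpG hqG hG

/-- The set `(N \ {1, u}) ∪ {y, y v}` has as many elements as `N`, and its quotients include those
of the larger set `N ∪ {y}`: a quotient inside `N` is realised because `N` has more than four
elements, and a missing quotient outside `N` would force `v ∈ {1, u, u⁻¹}`. -/
theorem not_strongCFS_of_normal (N : Subgroup G) [N.Normal] (hN : 4 < Nat.card N) {u y v : G}
    (hu : u ∈ Subgroup.center G) (huN : u ∈ N) (hu1 : u ≠ 1) (hy : y ∉ N) (hv : v ∈ N)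
    (hv1 : v ≠ 1) (hvu : v ≠ u) (hvu' : v ≠ u⁻¹) : ¬ StrongCFS G := by
  intro hG
  have hyv : y * v ∉ N := fun h => hy ((N.mul_mem_cancel_right hv).1 h)
  set A : Set G := ((N : Set G) \ {1, u}) ∪ {y, y * v} with hA
  have hAcard : A.ncard = Nat.card N := by
    have hsub : ({1, u} : Set G) ⊆ N := by
      rintro x (rfl | rfl)
      exacts [N.one_mem, huN]
    have hdisj : Disjoint ((N : Set G) \ {1, u}) {y, y * v} := by
      rw [Set.disjoint_left]
      rintro x ⟨hx, -⟩ (rfl | rfl)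
      exacts [hy hx, hyv hx]
    have hy2 : y ≠ y * v := fun h => hv1 (left_eq_mul.1 h)
    rw [hA, Set.ncard_union_eq hdisj, Set.ncard_pair hy2, ← Set.ncard_pair hu1.symm,
      Set.ncard_sdiff_add_ncard_of_subset hsub]
    rfl
  have hA'card : (insert y (N : Set G)).ncard = Nat.card N + 1 := by
    rw [Set.ncard_insert_of_notMem (by exact hy)]; rfl
  have memA : ∀ n ∈ N, n ≠ 1 → n ≠ u → n ∈ A := fun n hn h1 h2 => Or.inl ⟨hn, by simp [h1, h2]⟩
  have yA : y ∈ A := Or.inr (by simp)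
  have yvA : y * v ∈ A := Or.inr (by simp)
  -- to realise a given quotient inside `N \ {1, u}`, its numerator and its denominator have to
  -- avoid `1` and `u`, which rules out four candidates at most
  have avoid : ∀ c d : G, ∃ a ∈ N, a ≠ 1 ∧ a ≠ u ∧ a ≠ c ∧ a ≠ d := by
    intro c d
    classical
    obtain ⟨a, haN, ha⟩ : ∃ a ∈ (N : Set G), a ∉ (({1, u, c, d} : Finset G) : Set G) := by
      refine Set.exists_mem_notMem_of_ncard_lt_ncard (lt_of_le_of_lt ?_ hN)
      rw [Set.ncard_coe_finset]
      exact Finset.card_le_four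
    refine ⟨a, haN, ?_⟩
    simpa using ha
  have huc : ∀ x, x * u = u * x := fun x => Subgroup.mem_center_iff.1 hu x
  -- the conjugate of `v` avoids the same three elements as `v`, because `u` is central
  have hw1 : y * v * y⁻¹ ≠ 1 := fun h => hv1 (conj_eq_one_iff.1 h)
  have hwu : y * v * y⁻¹ ≠ u := fun h => hvu <| by
    rw [mul_inv_eq_iff_eq_mul, ← huc] at h
    exact mul_left_cancel h
  have hwu' : y * v * y⁻¹ ≠ u⁻¹ := fun h => hvu' <| by
    rw [mul_inv_eq_iff_eq_mul, eq_inv_mul_iff_mul_eq, ← mul_assoc, ← huc, mul_assoc,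
      mul_eq_left] at h
    exact eq_inv_of_mul_eq_one_right h
  have hwN : y * v * y⁻¹ ∈ N := Subgroup.Normal.conj_mem inferInstance v hv y
  -- a quotient of `y` and `n ∈ {1, u}` is realised by `y v` and a translate of `n` lying in `A`
  have key : ∀ t ∈ N, t ≠ 1 → t ≠ u → t ≠ u⁻¹ → ∀ n ∈ N, n = 1 ∨ n = u →
      n * t ∈ A ∧ t * n ∈ A := by
    rintro t ht h1 h2 h3 n hn (rfl | rfl)
    · rw [one_mul, mul_one]
      exact ⟨memA t ht h1 h2, memA t ht h1 h2⟩
    · rw [huc, and_self]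
      exact memA _ (N.mul_mem hn ht) (fun h => h3 (eq_inv_of_mul_eq_one_right h))
        (fun h => h1 (mul_eq_left.1 h))
  have hor : ∀ n ∈ N, n ∈ A ∨ (n = 1 ∨ n = u) := fun n hn => by
    by_cases h1 : n = 1
    · exact Or.inr (Or.inl h1)
    by_cases h2 : n = u
    · exact Or.inr (Or.inr h2)
    exact Or.inl (memA n hn h1 h2)
  refine not_isFactor_of_quotients (A' := insert y (N : Set G)) ?_ ?_ (by omega)
    (hG A (by rw [IsLagrangeSubset, hAcard]; exact N.card_subgroup_dvd_card))
  · rintro x (rfl | hx) z (rfl | hz)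
    · exact ⟨_, yA, by simpa using yA⟩
    · rcases hor z hz with h | h
      · exact ⟨_, yA, by simpa using h⟩
      · refine ⟨_, yvA, ?_⟩
        rw [← mul_assoc]
        exact (key _ hwN hw1 hwu hwu' z hz h).2
    · rcases hor x hx with h | h
      · exact ⟨_, h, by simpa using yA⟩
      · refine ⟨_, (key _ hwN hw1 hwu hwu' x hx h).2, ?_⟩
        convert yvA using 1
        group
    · obtain ⟨a, ha, h1, h2, h3, h4⟩ := avoid (x⁻¹ * z)⁻¹ (u * (x⁻¹ * z)⁻¹)
      refine ⟨a, memA a ha h1 h2, memA _ (N.mul_mem ha (N.mul_mem (N.inv_mem hx) hz)) ?_ ?_⟩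
      · exact fun h => h3 (eq_inv_of_mul_eq_one_left h)
      · exact fun h => h4 (eq_mul_inv_of_mul_eq h)
  · rintro x (rfl | hx) z (rfl | hz)
    · exact ⟨_, yA, by simpa using yA⟩
    · rcases hor z hz with h | h
      · exact ⟨_, h, by simpa using yA⟩
      · refine ⟨_, (key v hv hv1 hvu hvu' z hz h).1, ?_⟩
        convert yvA using 1
        group
    · rcases hor x hx with h | h
      · exact ⟨_, yA, by simpa using h⟩
      · refine ⟨_, yvA, ?_⟩
        convert (key v hv hv1 hvu hvu' x hx h).1 using 1
        group
    · obtain ⟨a, ha, h1, h2, h3, h4⟩ := avoid (x * z⁻¹)⁻¹ ((x * z⁻¹)⁻¹ * u)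
      refine ⟨a, memA a ha h1 h2, memA _ (N.mul_mem (N.mul_mem hx (N.inv_mem hz)) ha) ?_ ?_⟩
      · exact fun h => h3 (eq_inv_of_mul_eq_one_right h)
      · exact fun h => h4 (eq_inv_mul_of_mul_eq h)

theorem StrongCFS.card_normal_le_four (hG : StrongCFS G) (N : Subgroup G) [N.Normal] (hN : N ≠ ⊤)
    {u : G} (hu : u ∈ Subgroup.center G) (huN : u ∈ N) (hu1 : u ≠ 1) : Nat.card N ≤ 4 := by
  by_contra! h
  obtain ⟨y, -, hy⟩ := SetLike.exists_of_lt hN.lt_top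
  classical
  obtain ⟨v, hvN, hv⟩ : ∃ v ∈ (N : Set G), v ∉ (({1, u, u⁻¹} : Finset G) : Set G) := by
    refine Set.exists_mem_notMem_of_ncard_lt_ncard
      (lt_of_le_of_lt ?_ ((Nat.lt_succ_self 3).trans h))
    rw [Set.ncard_coe_finset]
    exact Finset.card_le_three
  simp only [Finset.coe_insert, Finset.coe_singleton, Set.mem_insert_iff, Set.mem_singleton_iff,
    not_or] at hv
  exact not_strongCFS_of_normal N h hu huN hu1 hy hvN hv.1 hv.2.1 hv.2.2 hG

/-- A `p`-group of order at least `p²` has a normal subgroup of index `p` that meets the centre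
nontrivially; that subgroup has at most four elements. -/
theorem StrongCFS.card_cases (hG : StrongCFS G) :
    Nat.card G = 1 ∨ (Nat.card G).Prime ∨ Nat.card G = 4 ∨ Nat.card G = 8 ∨ Nat.card G = 9 := by
  by_cases h1 : Nat.card G = 1
  · exact Or.inl h1
  obtain ⟨p, k, hp, hk⟩ := hG.exists_card_eq_prime_pow h1
  have := Fact.mk hp
  rcases k with _ | _ | k
  · simp [hk]
  · simp [hk, hp]
  have hnt : Nontrivial G := Finite.one_lt_card_iff_nontrivial.1 (by
    have := Nat.card_pos (α := G); omega)
  have hpG : IsPGroup p G := IsPGroup.of_card hk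
  have := hpG.center_nontrivial
  obtain ⟨m, hm0, hm⟩ := (hpG.to_subgroup (Subgroup.center G)).nontrivial_iff_card.1 this
  obtain ⟨u, hu⟩ := exists_prime_orderOf_dvd_card' (G := Subgroup.center G) p
    (hm ▸ dvd_pow_self p hm0.ne')
  rw [← Subgroup.orderOf_coe] at hu
  obtain ⟨N, hN, huN⟩ := Sylow.exists_subgroup_card_pow_prime_le p (n := 1) (m := k + 1)
    (hk ▸ pow_dvd_pow p (Nat.le_succ _)) (Subgroup.zpowers (u : G)) (by simp [hu]) (by omega)
  have hindex : N.index = p := by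
    have h := N.card_mul_index
    rw [hN, hk, pow_succ p (k + 1)] at h
    exact Nat.eq_of_mul_eq_mul_left (pow_pos hp.pos _) h
  have hnormal : N.Normal := Subgroup.normal_of_index_eq_minFac_card (by
    rw [hindex, hk, hp.pow_minFac (by omega)])
  have hle := hG.card_normal_le_four N
    (fun h => hp.one_lt.ne' (by rw [← hindex, h, Subgroup.index_top])) u.2
    (huN (Subgroup.mem_zpowers _)) (fun h => hp.one_lt.ne' (by rw [← hu, h, orderOf_one]))
  -- what remains is to list the prime powers `p ^ (k + 1) ≤ 4`
  rw [hN] at hle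
  have hp4 : p ≤ 4 := (Nat.le_self_pow (by omega) p).trans hle
  have hp2 := hp.two_le
  rw [hk]
  rcases k with _ | _ | k
  · interval_cases p
    · simp
    · simp
    · exact absurd hp (by norm_num)
  · interval_cases p
    · simp
    all_goals omega
  · have h8 : 2 ^ 3 ≤ p ^ (k + 1 + 1 + 1) :=
      (Nat.pow_le_pow_left hp2 3).trans (Nat.pow_le_pow_right hp.pos (by omega))
    omega

end Reduction

/-! ### Groups of order eight and nine -/

section SmallOrders

variable {G : Type*} [Group G] [Finite G]

theorem StrongCFS.pow_three_eq_one (hG : StrongCFS G) (h9 : Nat.card G = 9) (g : G) :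
    g ^ 3 = 1 := by
  by_contra hne
  have hg : orderOf g = 3 ^ (1 + 1) :=
    orderOf_eq_prime_pow (by simpa using hne) (by
      rw [← orderOf_dvd_iff_pow_eq_one]; exact (orderOf_dvd_natCard g).trans h9.dvd)
  -- the differences of `0, 1, 3` are `0, ±1, ±2, ±3`, the same as those of `0, 1, 2, 3`
  refine not_strongCFS_of_powersIn g {0, 1, 3} {0, 1, 2, 3} ?_ ?_ ?_ ?_ ?_ hG
  · rw [hg]; decide
  · rw [hg]; decide
  · rw [h9]; decide
  · decide
  · decide

theorem StrongCFS.pow_four_eq_one (hG : StrongCFS G) (h8 : Nat.card G = 8) (g : G) :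
    g ^ 4 = 1 := by
  by_contra hne
  have hg : orderOf g = 2 ^ (2 + 1) :=
    orderOf_eq_prime_pow (by simpa using hne) (by
      rw [← orderOf_dvd_iff_pow_eq_one]; exact (orderOf_dvd_natCard g).trans h8.dvd)
  -- the differences of `0, 1, 2, 4` are all the integers from `-4` to `4`
  refine not_strongCFS_of_powersIn g {0, 1, 2, 4} {0, 1, 2, 3, 4} ?_ ?_ ?_ ?_ ?_ hG
  · rw [hg]; decide
  · rw [hg]; decide
  · rw [h8]; decide
  · decide
  · decide

/-- In a group of order eight, a four-element set whose quotients exhaust the group on either side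
is not a factor. -/
theorem not_strongCFS_of_quotients_eq_univ (h8 : Nat.card G = 8) {A : Set G} (hA : A.ncard = 4)
    (hl : ∀ x, ∃ a ∈ A, a * x ∈ A) (hr : ∀ x, ∃ a ∈ A, x * a ∈ A) : ¬ StrongCFS G := by
  intro hG
  refine not_isFactor_of_quotients (A' := Set.univ) (fun _ _ _ _ => hl _) (fun _ _ _ _ => hr _)
    ?_ (hG A ?_)
  · rw [Set.ncard_univ, h8, hA]; norm_num
  · rw [IsLagrangeSubset, h8, hA]; norm_num

theorem eq_pow_of_mem_zpowers {G : Type*} [Group G] {g x : G} (hg : orderOf g = 4)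
    (hx : x ∈ Subgroup.zpowers g) :
    x = 1 ∨ x = g ∨ x = g * g ∨ x = g * g * g := by
  have hf : IsOfFinOrder g := orderOf_pos_iff.1 (by omega)
  obtain ⟨n, rfl⟩ := hf.mem_powers_iff_mem_zpowers.2 hx
  have hn := Nat.mod_lt n (show 0 < 4 by norm_num)
  simp only [← pow_mod_orderOf g n, hg]
  interval_cases n % 4 <;> simp [pow_succ]

/-- The elements of a group of order eight, in terms of an element `g` of order four and an element
`y` outside the subgroup generated by `g`. -/
theorem eq_of_card_eq_eight {G : Type*} [Group G] {g y : G} (hg : orderOf g = 4)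
    (hN : (Subgroup.zpowers g).index = 2) (hy : y ∉ Subgroup.zpowers g) (x : G) :
    (x = 1 ∨ x = g ∨ x = g * g ∨ x = g * g * g) ∨
      x = y ∨ x = g * y ∨ x = g * g * y ∨ x = g * g * g * y := by
  by_cases hx : x ∈ Subgroup.zpowers g
  · exact Or.inl (eq_pow_of_mem_zpowers hg hx)
  · right
    have h : x * y⁻¹ ∈ Subgroup.zpowers g := by
      rw [Subgroup.mul_mem_iff_of_index_two hN, inv_mem_iff]
      exact iff_of_false hx hy
    simpa only [mul_inv_eq_iff_eq_mul, one_mul] using eq_pow_of_mem_zpowers hg h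

/-- An element `g` of order four, together with an element `y` outside the subgroup it generates,
presents `G` as an abelian, dihedral or quaternion group; each has a four-element set whose
quotients exhaust `G`. -/
theorem StrongCFS.sq_eq_one (hG : StrongCFS G) (h8 : Nat.card G = 8) (g : G) : g ^ 2 = 1 := by
  by_contra hne
  have h4 := hG.pow_four_eq_one h8
  have hg : orderOf g = 4 := orderOf_eq_prime_pow (p := 2) (n := 1) (by simpa using hne) (h4 g)
  have hN : (Subgroup.zpowers g).index = 2 := by
    have h := (Subgroup.zpowers g).card_mul_index
    rw [Nat.card_zpowers, hg, h8] at h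
    omega
  have hnormal := Subgroup.normal_of_index_eq_two hN
  obtain ⟨y, -, hy⟩ := SetLike.exists_of_lt (lt_top_iff_ne_top.2
    fun h : Subgroup.zpowers g = ⊤ => by rw [h, Subgroup.index_top] at hN; omega)
  have g4 : g * (g * (g * g)) = 1 := by
    rw [← h4 g]; simp only [pow_succ, pow_zero, one_mul, mul_assoc]
  have g4' (z : G) : g * (g * (g * (g * z))) = z := by
    simpa only [mul_assoc, one_mul] using congrArg (· * z) g4
  have hgg1 : g * g ≠ 1 := by rwa [← pow_two]
  have hg1 : g ≠ 1 := fun h => hgg1 (by rw [h, one_mul])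
  have hgN := Subgroup.mem_zpowers g
  have hggN := (Subgroup.zpowers g).mul_mem hgN hgN
  -- `{1, g, g², y}` serves the abelian and quaternion groups, `{1, y, g², g y}` the dihedral one
  have card₁ : ∀ y ∉ Subgroup.zpowers g, ({1, g, g * g, y} : Set G).ncard = 4 := by
    intro y hy
    have h1 : y ≠ 1 := fun h => hy (h ▸ one_mem _)
    have h2 : y ≠ g := fun h => hy (h ▸ hgN)
    have h3 : y ≠ g * g := fun h => hy (h ▸ hggN)
    rw [Set.ncard_insert_of_notMem (by simp [hg1.symm, hgg1.symm, h1.symm]),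
      Set.ncard_insert_of_notMem (by simp [hg1, h2.symm]), Set.ncard_pair h3.symm]
  have card₂ : ({1, y, g * g, g * y} : Set G).ncard = 4 := by
    have h1 : y ≠ 1 := fun h => hy (h ▸ one_mem _)
    have h3 : y ≠ g * g := fun h => hy (h ▸ hggN)
    have hgy : g * y ∉ Subgroup.zpowers g := fun h =>
      hy (((Subgroup.zpowers g).mul_mem_cancel_left hgN).1 h)
    have h4 : g * y ≠ 1 := fun h => hgy (h ▸ one_mem _)
    have h5 : g * y ≠ g * g := fun h => hgy (h ▸ hggN)
    rw [Set.ncard_insert_of_notMem (by simp [h1.symm, hgg1.symm, h4.symm]),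
      Set.ncard_insert_of_notMem (by simp [h3, hg1]), Set.ncard_pair h5.symm]
  have hyy := eq_pow_of_mem_zpowers hg (Subgroup.mul_self_mem_of_index_two hN y)
  have y4 : y * y * (y * y) = 1 := by
    rw [← h4 y]; simp only [pow_succ, pow_zero, one_mul, mul_assoc]
  -- `y² = g` and `y² = g³` are impossible, because `y` would have order eight
  replace hyy : y * y = 1 ∨ y * y = g * g := by
    rcases hyy with h | h | h | h
    · exact Or.inl h
    · exact absurd (h ▸ y4) hgg1
    · exact Or.inr h
    · rw [h] at y4
      simp only [mul_assoc, g4'] at y4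
      exact absurd y4 hgg1
  have hconj := eq_pow_of_mem_zpowers hg (hnormal.conj_mem g hgN y)
  replace hconj : y * g = g * y ∨ y * g = g * g * g * y := by
    simp only [mul_inv_eq_iff_eq_mul, one_mul] at hconj
    rcases hconj with h | h | h | h
    · exact absurd (mul_eq_left.1 h) hg1
    · exact Or.inl h
    · have h2 : y * (g * g) = y * 1 := by
        rw [← mul_assoc, h, mul_assoc, h]
        simp only [mul_assoc, g4', mul_one]
      exact absurd (mul_left_cancel h2) hgg1
    · exact Or.inr h
  -- in each case below the relations rewrite every product to the form `gⁱ yʲ`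
  rcases hconj with hc | hc
  · -- `G` is abelian, and `y` may be taken to be an involution
    obtain ⟨z, hz, hzz, hzc⟩ : ∃ z ∉ Subgroup.zpowers g, z * z = 1 ∧ z * g = g * z := by
      rcases hyy with h | h
      · exact ⟨y, hy, h, hc⟩
      · refine ⟨g * y, fun h => hy (((Subgroup.zpowers g).mul_mem_cancel_left hgN).1 h), ?_, ?_⟩
        · rw [mul_assoc, ← mul_assoc y, hc, mul_assoc g y, h]
          simp only [g4]
        · rw [mul_assoc, hc]
    have hzc' (w : G) : z * (g * w) = g * (z * w) := by rw [← mul_assoc, hzc, mul_assoc]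
    have cover : ∀ x : G, ∃ a ∈ ({1, g, g * g, z} : Set G), x * a ∈ ({1, g, g * g, z} : Set G) ∧
        a * x ∈ ({1, g, g * g, z} : Set G) := by
      intro x
      rcases eq_of_card_eq_eight hg hN hz x with (h | h | h | h) | h | h | h | h <;> rw [h]
      · exact ⟨1, by simp⟩
      · exact ⟨1, by simp⟩
      · exact ⟨1, by simp⟩
      · exact ⟨g, by simp [mul_assoc, g4]⟩
      · exact ⟨1, by simp⟩
      · exact ⟨z, by simp [mul_assoc, hzc', hzz]⟩
      · exact ⟨g * g, by simp [mul_assoc, hzc', hzc, g4']⟩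
      · exact ⟨g, by simp [mul_assoc, hzc, g4']⟩
    exact not_strongCFS_of_quotients_eq_univ h8 (card₁ z hz)
      (fun x => let ⟨a, ha, h⟩ := cover x; ⟨a, ha, h.2⟩)
      (fun x => let ⟨a, ha, h⟩ := cover x; ⟨a, ha, h.1⟩) hG
  · have hc' (w : G) : y * (g * w) = g * (g * (g * (y * w))) := by
      rw [← mul_assoc, hc]; simp only [mul_assoc]
    rw [mul_assoc, mul_assoc] at hc
    rcases hyy with hyy | hyy
    · -- `G` is dihedral
      refine not_strongCFS_of_quotients_eq_univ h8 card₂ (fun x => ?_) (fun x => ?_) hG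
      · rcases eq_of_card_eq_eight hg hN hy x with (h | h | h | h) | h | h | h | h <;> rw [h]
        · exact ⟨1, by simp⟩
        · exact ⟨g * y, by simp [mul_assoc, hc, g4']⟩
        · exact ⟨1, by simp⟩
        · exact ⟨y, by simp [mul_assoc, hc', hc, g4']⟩
        · exact ⟨1, by simp⟩
        · exact ⟨1, by simp⟩
        · exact ⟨y, by simp [mul_assoc, hc', hyy, g4']⟩
        · exact ⟨g * g, by simp [mul_assoc, g4']⟩
      · rcases eq_of_card_eq_eight hg hN hy x with (h | h | h | h) | h | h | h | h <;> rw [h]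
        · exact ⟨1, by simp⟩
        · exact ⟨y, by simp⟩
        · exact ⟨1, by simp⟩
        · exact ⟨g * y, by simp [mul_assoc, g4']⟩
        · exact ⟨1, by simp⟩
        · exact ⟨1, by simp⟩
        · exact ⟨y, by simp [mul_assoc, hyy]⟩
        · exact ⟨g * g, by simp [mul_assoc, hc', hc, g4']⟩
    · -- `G` is the quaternion group
      refine not_strongCFS_of_quotients_eq_univ h8 (card₁ y hy) (fun x => ?_) (fun x => ?_) hG
      · rcases eq_of_card_eq_eight hg hN hy x with (h | h | h | h) | h | h | h | h <;> rw [h]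
        · exact ⟨1, by simp⟩
        · exact ⟨1, by simp⟩
        · exact ⟨1, by simp⟩
        · exact ⟨g, by simp [mul_assoc, g4]⟩
        · exact ⟨1, by simp⟩
        · exact ⟨y, by simp [hc', hyy, g4']⟩
        · exact ⟨g * g, by simp [mul_assoc, g4']⟩
        · exact ⟨g, by simp [mul_assoc, g4']⟩
      · rcases eq_of_card_eq_eight hg hN hy x with (h | h | h | h) | h | h | h | h <;> rw [h]
        · exact ⟨1, by simp⟩
        · exact ⟨1, by simp⟩
        · exact ⟨1, by simp⟩
        · exact ⟨g, by simp [mul_assoc, g4]⟩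
        · exact ⟨1, by simp⟩
        · exact ⟨g, by simp [mul_assoc, hc, g4']⟩
        · exact ⟨g * g, by simp [mul_assoc, hc', hc, g4']⟩
        · exact ⟨y, by simp [mul_assoc, hyy, g4']⟩

end SmallOrders

/-! ### Identification of the groups -/

theorem nonempty_addEquiv_pi_zmod {V : Type*} [AddCommGroup V] [Finite V] {p n : ℕ}
    [Fact p.Prime] [Module (ZMod p) V] (hcard : Nat.card V = p ^ n) :
    Nonempty (V ≃+ (Fin n → ZMod p)) := by
  have hrank : Module.finrank (ZMod p) V = Module.finrank (ZMod p) (Fin n → ZMod p) := by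
    rw [Module.finrank_fin_fun]
    have h := Module.natCard_eq_pow_finrank (K := ZMod p) (V := V)
    rw [Nat.card_zmod, hcard] at h
    exact (Nat.pow_right_injective (Fact.out : p.Prime).two_le h).symm
  exact (FiniteDimensional.nonempty_linearEquiv_of_finrank_eq hrank).map LinearEquiv.toAddEquiv

/-- A finite abelian group of prime exponent `p` is a vector space over `ZMod p`, hence determined
by its order. -/
theorem nonempty_mulEquiv_pi_zmod {G : Type*} [Group G] [Finite G] {p n : ℕ} [Fact p.Prime]
    (hcomm : ∀ a b : G, a * b = b * a) (hexp : ∀ a : G, a ^ p = 1) (hcard : Nat.card G = p ^ n) :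
    Nonempty (G ≃* (Fin n → Multiplicative (ZMod p))) := by
  let _ : CommGroup G := { ‹Group G› with mul_comm := hcomm }
  obtain ⟨e⟩ : Nonempty (Additive G ≃+ (Fin n → ZMod p)) :=
    have := AddCommGroup.zmodModule (G := Additive G) (n := p) fun x => hexp x.toMul
    nonempty_addEquiv_pi_zmod ((Nat.card_congr Additive.toMul).trans hcard)
  exact ⟨{ toFun := fun g i => Multiplicative.ofAdd (e (Additive.ofMul g) i)
           invFun := fun f => (e.symm fun i => (f i).toAdd).toMul
           left_inv := fun g => by simp
           right_inv := fun f => by simp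
           map_mul' := fun g h => by ext i; simp }⟩

theorem mul_comm_of_sq_eq_one {G : Type*} [Group G] (h : ∀ g : G, g ^ 2 = 1) (a b : G) :
    a * b = b * a := by
  have hinv (x : G) : x⁻¹ = x := inv_eq_of_mul_eq_one_left (by rw [← pow_two, h])
  rw [← hinv (a * b), mul_inv_rev, hinv, hinv]

theorem nonempty_mulEquiv_of_card_eq_four {G : Type*} [Group G] [Finite G] (h4 : Nat.card G = 4) :
    Nonempty (G ≃* (Fin 2 → Multiplicative (ZMod 2))) ∨
      Nonempty (G ≃* Multiplicative (ZMod 4)) := by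
  by_cases h : ∀ g : G, g ^ 2 = 1
  · exact Or.inl (nonempty_mulEquiv_pi_zmod (mul_comm_of_sq_eq_one h) h h4)
  · push Not at h
    obtain ⟨g, hg⟩ := h
    have hord : orderOf g = 2 ^ (1 + 1) := orderOf_eq_prime_pow (by simpa using hg) (by
      rw [← orderOf_dvd_iff_pow_eq_one]; exact (orderOf_dvd_natCard g).trans h4.dvd)
    have hcyc : IsCyclic G := isCyclic_of_orderOf_eq_card g (by rw [hord, h4]; rfl)
    exact Or.inr ⟨mulEquivOfCyclicCardEq (by simp [h4])⟩

/-! ### Factorizations in the exceptional groups -/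

section Factors

/-- For sets whose sizes multiply to at least `|G|`, it is enough that products determine their left
factor: they then determine the right one, and counting gives surjectivity. -/
theorem isLeftFactor_of_injective {G : Type*} [Group G] [Finite G] {A B : Set G}
    (hcard : Nat.card G ≤ A.ncard * B.ncard)
    (hinj : ∀ a ∈ A, ∀ a' ∈ A, ∀ b ∈ B, ∀ b' ∈ B, a * b = a' * b' → a = a') : IsLeftFactor A := by
  refine ⟨B, Function.Injective.bijective_of_nat_card_le ?_ ?_⟩
  · rintro ⟨⟨a, ha⟩, b, hb⟩ ⟨⟨a', ha'⟩, b', hb'⟩ h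
    replace h : a * b = a' * b' := h
    obtain rfl := hinj a ha a' ha' b hb b' hb' h
    obtain rfl := mul_left_cancel h
    rfl
  · rwa [Nat.card_prod, Nat.card_coe_set_eq, Nat.card_coe_set_eq]

theorem isFactor_of_ncard_eq_one {G : Type*} [Group G] {A : Set G} (h : A.ncard = 1) :
    IsFactor A := by
  obtain ⟨a, rfl⟩ := Set.ncard_eq_one.1 h
  exact Or.inl ⟨_, Subgroup.isComplement_singleton_univ⟩

variable {G : Type*} [Group G] [Finite G]

theorem isFactor_of_ncard_eq_card {A : Set G} (h : A.ncard = Nat.card G) : IsFactor A := by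
  obtain rfl : A = Set.univ := Set.eq_of_subset_of_ncard_le (Set.subset_univ A)
    (by rw [h, Set.ncard_univ])
  exact Or.inl ⟨_, Subgroup.isComplement_univ_singleton (g := 1)⟩

theorem strongCFS_of_card_eq_one_or_prime (h : Nat.card G = 1 ∨ (Nat.card G).Prime) :
    StrongCFS G := by
  intro A hA
  rw [IsLagrangeSubset] at hA
  rcases h with h | h
  · rw [h, Nat.dvd_one] at hA
    exact isFactor_of_ncard_eq_one hA
  · exact ((Nat.dvd_prime h).1 hA).elim isFactor_of_ncard_eq_one isFactor_of_ncard_eq_card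

/-- A set with half as many elements as `G` is a factor as soon as its quotients miss an
element `k`: the other factor is `{1, k}`. -/
theorem isFactor_of_two_mul_ncard {A : Set G} (hcard : Nat.card G = 2 * A.ncard) {k : G}
    (hk1 : k ≠ 1) (hk : ∀ a ∈ A, ∀ a' ∈ A, a⁻¹ * a' ≠ k) : IsFactor A := by
  refine Or.inl (isLeftFactor_of_injective (B := {1, k}) ?_ ?_)
  · rw [Set.ncard_pair hk1.symm, hcard, mul_comm]
  · rintro a ha a' ha' b (rfl | rfl) b' (rfl | rfl) h
    · simpa using h
    · rw [mul_one] at h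
      exact absurd (inv_mul_eq_iff_eq_mul.2 h) (hk a' ha' a ha)
    · rw [mul_one] at h
      exact absurd (inv_mul_eq_iff_eq_mul.2 h.symm) (hk a ha a' ha')
    · exact mul_right_cancel h

/-- In a group of order four the quotients of a pair `{a, b}` are `1`, `a⁻¹ b` and `b⁻¹ a`, so one
element is missed. -/
theorem strongCFS_of_card_eq_four (h4 : Nat.card G = 4) : StrongCFS G := by
  intro A hA
  have hA' : A.ncard ∣ 4 := h4 ▸ hA
  have hle := Nat.le_of_dvd (by norm_num) hA'
  interval_cases hn : A.ncard
  · omega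
  · exact isFactor_of_ncard_eq_one hn
  · obtain ⟨a, b, hab, rfl⟩ := Set.ncard_eq_two.1 hn
    classical
    obtain ⟨k, -, hk⟩ : ∃ k ∈ (Set.univ : Set G),
        k ∉ (({1, a⁻¹ * b, b⁻¹ * a} : Finset G) : Set G) := by
      refine Set.exists_mem_notMem_of_ncard_lt_ncard ?_
      rw [Set.ncard_univ, h4, Set.ncard_coe_finset]
      exact Nat.lt_succ_of_le Finset.card_le_three
    simp only [Finset.coe_insert, Finset.coe_singleton, Set.mem_insert_iff, Set.mem_singleton_iff,
      not_or] at hk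
    refine isFactor_of_two_mul_ncard (by rw [h4, hn]) hk.1 ?_
    rintro x (rfl | rfl) y (rfl | rfl) h
    all_goals simp_all
  · omega
  · exact isFactor_of_ncard_eq_card (hn.trans h4.symm)

/-- A four-element set spans only six pairs, and in exponent two each pair contributes a single
quotient, so one of the seven nontrivial elements is missed. A pair `{a, b}` is complemented by the
kernel of a character that separates `a` from `b`. -/
theorem strongCFS_of_mulEquiv_two_cube (e : G ≃* (Fin 3 → Multiplicative (ZMod 2))) :
    StrongCFS G := by
  have h8 : Nat.card G = 8 := by rw [Nat.card_congr e.toEquiv]; simp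
  have hsq : ∀ x : G, x * x = 1 := fun x => e.injective (by
    rw [map_mul, map_one]; generalize e x = y; revert y; decide)
  have hinv : ∀ x : G, x⁻¹ = x := fun x => inv_eq_of_mul_eq_one_left (hsq x)
  intro A hA
  have hA' : A.ncard ∣ 8 := h8 ▸ hA
  have hmem : A.ncard ∈ Nat.divisors 8 := Nat.mem_divisors.2 ⟨hA', by norm_num⟩
  rw [show Nat.divisors 8 = {1, 2, 4, 8} by decide] at hmem
  simp only [Finset.mem_insert, Finset.mem_singleton] at hmem
  rcases hmem with hn | hn | hn | hn
  · exact isFactor_of_ncard_eq_one hn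
  · -- the character is a coordinate in which `a` and `b` differ
    obtain ⟨a, b, hab, rfl⟩ := Set.ncard_eq_two.1 hn
    obtain ⟨i, hi⟩ := Function.ne_iff.1 (e.injective.ne hab)
    let f : G →* Multiplicative (ZMod 2) := (Pi.evalMonoidHom _ i).comp e.toMonoidHom
    have hker : Nat.card f.ker = 4 := by
      have hc := f.ker.card_mul_index
      rw [Subgroup.index_ker, h8] at hc
      have hs : Function.Surjective f := (Function.surjective_eval i).comp e.surjective
      rw [f.range_eq_top.2 hs, Subgroup.card_top] at hc
      rw [Nat.card_congr Multiplicative.toAdd, Nat.card_zmod] at hc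
      omega
    refine Or.inl (isLeftFactor_of_injective (B := f.ker) ?_ ?_)
    · rw [h8, hn, ← Nat.card_coe_set_eq]
      exact (Nat.mul_le_mul_left 2 hker.ge)
    · have hf : f a ≠ f b := hi
      rintro x hx y hy c hc d hd h
      have hxy : f x = f y := by
        have := congrArg f h
        rwa [map_mul, map_mul, MonoidHom.mem_ker.1 hc, MonoidHom.mem_ker.1 hd, mul_one,
          mul_one] at this
      rcases hx with rfl | rfl <;> rcases hy with rfl | rfl <;> simp_all
  · obtain ⟨a, b, c, d, -, -, -, -, -, -, rfl⟩ := Set.ncard_eq_four.1 hn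
    classical
    obtain ⟨k, -, hk⟩ : ∃ k ∈ (Set.univ : Set G),
        k ∉ (({1, a * b, a * c, a * d, b * c, b * d, c * d} : Finset G) : Set G) := by
      refine Set.exists_mem_notMem_of_ncard_lt_ncard ?_
      rw [Set.ncard_univ, h8, Set.ncard_coe_finset]
      exact Nat.lt_succ_of_le
        ((Finset.card_insert_le _ _).trans (Nat.succ_le_succ Finset.card_le_six))
    simp only [Finset.coe_insert, Finset.coe_singleton, Set.mem_insert_iff, Set.mem_singleton_iff,
      not_or] at hk
    have hcomm := mul_comm_of_sq_eq_one fun x => (pow_two x).trans (hsq x)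
    refine isFactor_of_two_mul_ncard (by rw [h8, hn]) hk.1 ?_
    intro x hx y hy h
    simp only [Set.mem_insert_iff, Set.mem_singleton_iff] at hx hy
    rw [hinv] at h
    grind
  · exact isFactor_of_ncard_eq_card (hn.trans h8.symm)

theorem eq_of_mem_zpowers_of_orderOf_eq_three {G : Type*} [Group G] {k x : G} (hk : orderOf k = 3)
    (hx : x ∈ Subgroup.zpowers k) : x = 1 ∨ x = k ∨ x = k⁻¹ := by
  have hf : IsOfFinOrder k := orderOf_pos_iff.1 (by omega)
  obtain ⟨n, rfl⟩ := hf.mem_powers_iff_mem_zpowers.2 hx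
  have hk2 : k ^ 2 = k⁻¹ :=
    eq_inv_of_mul_eq_one_left (by rw [← pow_succ]; exact orderOf_dvd_iff_pow_eq_one.1 hk.dvd)
  have hn := Nat.mod_lt n (show 0 < 3 by norm_num)
  simp only [← pow_mod_orderOf k n, hk]
  interval_cases n % 3 <;> simp [hk2]

/-- The six quotients of distinct elements of a triple miss one of the eight nontrivial elements
`k`, and then they miss `k⁻¹` as well, so the triple is complemented by the subgroup
`{1, k, k⁻¹}`. -/
theorem strongCFS_of_mulEquiv_three_sq (e : G ≃* (Fin 2 → Multiplicative (ZMod 3))) :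
    StrongCFS G := by
  have h9 : Nat.card G = 9 := by rw [Nat.card_congr e.toEquiv]; simp
  have hcube : ∀ x : G, x ^ 3 = 1 := fun x => e.injective (by
    rw [map_pow, map_one]; generalize e x = y; revert y; decide)
  intro A hA
  have hA' : A.ncard ∣ 9 := h9 ▸ hA
  have hmem : A.ncard ∈ Nat.divisors 9 := Nat.mem_divisors.2 ⟨hA', by norm_num⟩
  rw [show Nat.divisors 9 = {1, 3, 9} by decide] at hmem
  simp only [Finset.mem_insert, Finset.mem_singleton] at hmem
  rcases hmem with hn | hn | hn
  · exact isFactor_of_ncard_eq_one hn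
  · obtain ⟨a, b, c, -, -, -, rfl⟩ := Set.ncard_eq_three.1 hn
    classical
    obtain ⟨k, -, hk⟩ : ∃ k ∈ (Set.univ : Set G),
        k ∉ (({1, a⁻¹ * b, b⁻¹ * a, a⁻¹ * c, c⁻¹ * a, b⁻¹ * c, c⁻¹ * b} : Finset G) : Set G) := by
      refine Set.exists_mem_notMem_of_ncard_lt_ncard ?_
      rw [Set.ncard_univ, h9, Set.ncard_coe_finset]
      exact ((Finset.card_insert_le _ _).trans (Nat.succ_le_succ Finset.card_le_six)).trans_lt
        (by norm_num)
    simp only [Finset.coe_insert, Finset.coe_singleton, Set.mem_insert_iff, Set.mem_singleton_iff,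
      not_or] at hk
    have hk' : ∀ x ∈ ({a, b, c} : Set G), ∀ y ∈ ({a, b, c} : Set G), x⁻¹ * y ≠ k := by
      intro x hx y hy h
      simp only [Set.mem_insert_iff, Set.mem_singleton_iff] at hx hy
      have := inv_mul_cancel x
      grind
    have hord : orderOf k = 3 := orderOf_eq_prime (hcube k) hk.1
    refine Or.inl (isLeftFactor_of_injective (B := Subgroup.zpowers k) ?_ ?_)
    · rw [h9, hn, ← Nat.card_coe_set_eq]
      exact (Nat.mul_le_mul_left 3 (Nat.card_zpowers k ▸ hord).ge)
    · intro x hx y hy z hz w hw h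
      have hxy : x⁻¹ * y ∈ Subgroup.zpowers k := by
        have : x⁻¹ * y = z * w⁻¹ := by
          rw [inv_mul_eq_iff_eq_mul, ← mul_assoc, h, mul_inv_cancel_right]
        rw [this]
        exact mul_mem hz (inv_mem hw)
      rcases eq_of_mem_zpowers_of_orderOf_eq_three hord hxy with h1 | h1 | h1
      · exact inv_mul_eq_one.1 h1
      · exact absurd h1 (hk' x hx y hy)
      · exact absurd (by rw [← inv_inj, ← h1, mul_inv_rev, inv_inv]) (hk' y hy x hx)
  · exact isFactor_of_ncard_eq_card (hn.trans h9.symm)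

end Factors

/-! ### The classification -/

theorem mainTheorem1 (G : Type*) [Group G] [Finite G] :
    StrongCFS G ↔
      (Subsingleton G ∨
        (∃ p : ℕ, p.Prime ∧ Nonempty (G ≃* Multiplicative (ZMod p))) ∨
        Nonempty (G ≃* (Fin 2 → Multiplicative (ZMod 2))) ∨
        Nonempty (G ≃* Multiplicative (ZMod 4)) ∨
        Nonempty (G ≃* (Fin 3 → Multiplicative (ZMod 2))) ∨
        Nonempty (G ≃* (Fin 2 → Multiplicative (ZMod 3)))) := by
  constructor
  · intro hG
    rcases hG.card_cases with h | h | h | h | h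
    · exact Or.inl (Nat.card_eq_one_iff_unique.1 h).1
    · have := Fact.mk h
      exact Or.inr (Or.inl ⟨_, h, ⟨mulEquivOfPrimeCardEq rfl (by simp)⟩⟩)
    · rcases nonempty_mulEquiv_of_card_eq_four h with e | e
      · exact Or.inr (Or.inr (Or.inl e))
      · exact Or.inr (Or.inr (Or.inr (Or.inl e)))
    · have hsq := hG.sq_eq_one h
      exact Or.inr (Or.inr (Or.inr (Or.inr (Or.inl
        (nonempty_mulEquiv_pi_zmod (mul_comm_of_sq_eq_one hsq) hsq h)))))
    · have := IsPGroup.isMulCommutative_of_card_eq_prime_sq (p := 3) h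
      exact Or.inr (Or.inr (Or.inr (Or.inr (Or.inr
        (nonempty_mulEquiv_pi_zmod mul_comm' (hG.pow_three_eq_one h) h)))))
  · rintro (h | ⟨p, hp, ⟨e⟩⟩ | ⟨⟨e⟩⟩ | ⟨⟨e⟩⟩ | ⟨⟨e⟩⟩ | ⟨⟨e⟩⟩)
    · exact strongCFS_of_card_eq_one_or_prime (Or.inl Nat.card_unique)
    · refine strongCFS_of_card_eq_one_or_prime (Or.inr ?_)
      rwa [Nat.card_congr e.toEquiv, Nat.card_congr Multiplicative.toAdd, Nat.card_zmod]
    · exact strongCFS_of_card_eq_four (by rw [Nat.card_congr e.toEquiv]; simp)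
    · exact strongCFS_of_card_eq_four (by rw [Nat.card_congr e.toEquiv]; simp)
    · exact strongCFS_of_mulEquiv_two_cube e
    · exact strongCFS_of_mulEquiv_three_sq e
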